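/- Let $k$ be an algebraically closed field of characteristic zero, $r\ge 0$, $R=k[x_0,\dots,x_r]$, $\bar R=k[x_1,\dots,x_r]$, and use the graded lexicographic order with $x_0>x_1>\dots>x_r$ on both rings. Write $\mathrm{in}(J)$ for the initial ideal of an ideal $J$. A Gröbner basis of $J$ is a finite set of nonzero elements of $J$ whose leading terms generate $\mathrm{in}(J)$. A homogeneous ideal $J$ in a polynomial ring in $n$ variables over $k$ is in generic coordinates if $\mathrm{in}(J)=\mathrm{Gin}(J)$, that is, if there is a nonempty Zariski open set $U\subset GL_n(k)$ such that $\mathrm{in}(g(J))=\mathrm{in}(J)$ for all $g\in U$. For a homogeneous $f\in R$, $f\neq 0$, let $d_0(f)$ be the exponent of $x_0$ in the leading term of $f$; then $f=x_0^{d_0(f)}\bar f+g$ with a unique nonzero $\bar f\in\bar R$ and $g$ of degree less than $d_0(f)$ in $x_0$. For a homogeneous ideal $I\subset R$ and $i\ge 0$, the $i$-th partial elimination ideal $K_i(I)\subset\bar R$ is the image of $\widetilde K_i(I)=\bigoplus_{d}\{f\in I_d : f=0 \text{ or } d_0(f)\le i\}$ under the map that sends $f$ to the coefficient in $\bar R$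 of $x_0^i$ in $f$. **Proposition.** Let $I\subset R$ be a homogeneous ideal in generic coordinates, and let $G$ be a Gröbner basis of $I$ consisting of homogeneous polynomials. Let $\beta=\min\{j : I_j\ne 0\}$ ($\beta=\infty$ if $I=0$). (a) For every $i\ge 0$, $K_i(I)$ is a homogeneous ideal in generic coordinates. (b) For every $0\le i\le\beta$ ($i$ finite), $G_i=\{\bar f : f\in G,\ d_0(f)=i\}$ is a Gröbner basis of $K_i(I)$. (c) Let $i\ge 0$ and let $M$ be a monomial of $\bar R$. If $x_0^iM$ is a minimal generator of $\mathrm{in}(I)$, then $M$ is a minimal generator of $\mathrm{in}(K_i(I))$. The converse holds whenever $i\le\beta$ or $M\ne 1$. In particular, for $0\le i\le\beta$, $x_0^iM$ is a minimal generator of $\mathrm{in}(I)$ if and only if $M$ is a minimal generator of $\mathrm{in}(K_i(I))$. -/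

import Mathlib

open MvPolynomial

attribute [local instance] MvPolynomial.gradedAlgebra

noncomputable section

/-- The initial ideal of `I` for a monomial order: the ideal generated by the leading terms
of the elements of `I`. -/
def initialIdeal {σ k : Type*} [Field k] (m : MonomialOrder σ)
    (I : Ideal (MvPolynomial σ k)) : Ideal (MvPolynomial σ k) :=
  Ideal.span (m.leadingTerm '' (I : Set (MvPolynomial σ k)))

/-- A Gröbner basis of `I`: a finite set of nonzero elements of `I` whose leading terms
generate the initial ideal of `I`. -/
structure IsGroebnerBasis {σ k : Type*} [Field k] (m : MonomialOrder σ)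
    (I : Ideal (MvPolynomial σ k)) (G : Set (MvPolynomial σ k)) : Prop where
  finite : G.Finite
  zero_notMem : (0 : MvPolynomial σ k) ∉ G
  subset : G ⊆ (I : Set (MvPolynomial σ k))
  span_eq : Ideal.span (m.leadingTerm '' G) = initialIdeal m I

/-- The monomial `x ^ M` is a minimal (monomial) generator of the monomial ideal `J`: it lies
in `J` and no proper divisor of it does. -/
def IsMinimalGenerator {σ k : Type*} [Field k]
    (J : Ideal (MvPolynomial σ k)) (M : σ →₀ ℕ) : Prop :=
  Minimal (fun N : σ →₀ ℕ => monomial N (1 : k) ∈ J) M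

/-- The linear change of coordinates `x_j ↦ ∑ i, g i j • x_i` attached to `g`. -/
def coordChange {n : ℕ} {k : Type*} [Field k] (g : GL (Fin n) k) :
    MvPolynomial (Fin n) k →ₐ[k] MvPolynomial (Fin n) k :=
  aeval fun j => ∑ i, C ((g : Matrix (Fin n) (Fin n) k) i j) * X i

/-- The ideal `g(I)` (each `coordChange g` is an automorphism). -/
def transform {n : ℕ} {k : Type*} [Field k] (g : GL (Fin n) k)
    (I : Ideal (MvPolynomial (Fin n) k)) : Ideal (MvPolynomial (Fin n) k) :=
  I.map (coordChange g)

/-- Zariski open subsets of `GL_n(k)`: complements of the common zero locus of a set of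
polynomials in the matrix entries. -/
def IsZariskiOpen {n : ℕ} {k : Type*} [Field k] (U : Set (GL (Fin n) k)) : Prop :=
  ∃ S : Set (MvPolynomial (Fin n × Fin n) k),
    U = {g : GL (Fin n) k | ∃ p ∈ S, eval (fun ij => (g : Matrix (Fin n) (Fin n) k) ij.1 ij.2) p ≠ 0}

/-- `J` is the generic initial ideal of `I`: `in(g(I)) = J` for all `g` in a nonempty
Zariski open subset of `GL_n(k)`. -/
def IsGenericInitialIdeal {n : ℕ} {k : Type*} [Field k] (m : MonomialOrder (Fin n))
    (I J : Ideal (MvPolynomial (Fin n) k)) : Prop :=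
  ∃ U : Set (GL (Fin n) k), IsZariskiOpen U ∧ U.Nonempty ∧
    ∀ g ∈ U, initialIdeal m (transform g I) = J

/-- `I` is in generic coordinates: its initial ideal is its generic initial ideal. -/
def InGenericCoordinates {n : ℕ} {k : Type*} [Field k] (m : MonomialOrder (Fin n))
    (I : Ideal (MvPolynomial (Fin n) k)) : Prop :=
  IsGenericInitialIdeal m I (initialIdeal m I)

/-- `d₀(f)`: the exponent of `x_0` in the leading term of `f` for the graded lexicographic
order with `x_0 > x_1 > ⋯ > x_r`. -/
def leadPower {r : ℕ} {k : Type*} [Field k] (f : MvPolynomial (Fin (r + 1)) k) : ℕ :=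
  MonomialOrder.degLex.degree f 0

/-- The coefficient in `k[x_1, …, x_r]` of `x_0 ^ i` in `f`. If `f` is homogeneous and
`d₀(f) ≤ i`, this is the unique `f̄` with `f = x_0 ^ i * f̄ + g` and all exponents of `x_0`
in `g` smaller than `i`. -/
def coeffXZero {r : ℕ} {k : Type*} [Field k] (i : ℕ) :
    MvPolynomial (Fin (r + 1)) k →ₗ[k] MvPolynomial (Fin r) k :=
  (Polynomial.lcoeff (MvPolynomial (Fin r) k) i).restrictScalars k ∘ₗ
    (finSuccEquiv k r).toLinearMap

/-- `K̃_i(I) = ⨁_d {f ∈ I_d | d₀(f) ≤ i}`. -/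
def partialElimAux {r : ℕ} {k : Type*} [Field k] (i : ℕ)
    (I : Ideal (MvPolynomial (Fin (r + 1)) k)) : Submodule k (MvPolynomial (Fin (r + 1)) k) :=
  Submodule.span k {f | f ∈ I ∧ (∃ d, f.IsHomogeneous d) ∧ leadPower f ≤ i}

theorem leadPower_eq_degreeOf {r : ℕ} {k : Type*} [Field k]
    {f : MvPolynomial (Fin (r + 1)) k} {d : ℕ} (hf : f.IsHomogeneous d) :
    leadPower f = f.degreeOf 0 := by
  by_cases h0 : f = 0
  · simp [h0, leadPower]
  have hdeg : ∀ m ∈ f.support, m.degree = d := fun m hm => by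
    have := hf (mem_support_iff.mp hm)
    rw [Finsupp.degree_eq_weight_one]
    exact this
  have hsupp : MonomialOrder.degLex.degree f ∈ f.support := MonomialOrder.degree_mem_support h0
  apply le_antisymm
  · exact monomial_le_degreeOf 0 hsupp
  · rw [degreeOf_le_iff]
    intro m hm
    have hle := MonomialOrder.degLex.le_degree hm
    rw [MonomialOrder.degLex_le_iff, Finsupp.DegLex.le_iff] at hle
    simp only [ofDegLex_toDegLex, hdeg m hm, hdeg _ hsupp, lt_irrefl, true_and, false_or] at hle
    rcases hle.lt_or_eq with hlt | heq
    · obtain ⟨j, hj, hlt⟩ := hlt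
      by_cases hj0 : j = 0
      · subst hj0
        exact hlt.le
      · exact (hj 0 (Fin.pos_of_ne_zero hj0)).le
    · have : m = MonomialOrder.degLex.degree f := heq
      rw [leadPower, ← this]

theorem coeffXZero_rename_mul {r : ℕ} {k : Type*} [Field k] (i : ℕ)
    (c : MvPolynomial (Fin r) k) (f : MvPolynomial (Fin (r + 1)) k) :
    coeffXZero i (rename Fin.succ c * f) = c * coeffXZero i f := by
  have h : finSuccEquiv k r (rename Fin.succ c) = Polynomial.C c := by
    induction c using MvPolynomial.induction_on with
    | C a => simp [finSuccEquiv_apply]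
    | add p q hp hq => simp [hp, hq]
    | mul_X p n hp => simp [hp, finSuccEquiv_X_succ]
  simp [coeffXZero, h]

theorem rename_monomial_mul_mem {r : ℕ} {k : Type*} [Field k] (i : ℕ)
    (I : Ideal (MvPolynomial (Fin (r + 1)) k)) (u : Fin r →₀ ℕ) (a : k)
    {f : MvPolynomial (Fin (r + 1)) k} (hf : f ∈ partialElimAux i I) :
    rename Fin.succ (monomial u a) * f ∈ partialElimAux i I := by
  induction hf using Submodule.span_induction with
  | zero => simp
  | add x y _ _ hx hy => rw [mul_add]; exact add_mem hx hy
  | smul b x _ hx => rw [mul_smul_comm]; exact Submodule.smul_mem _ b hx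
  | mem x hx =>
    obtain ⟨hxI, ⟨d, hd⟩, hxi⟩ := hx
    have hh : (rename Fin.succ (monomial u a) * x).IsHomogeneous (u.degree + d) :=
      ((isHomogeneous_monomial a rfl).rename_isHomogeneous).mul hd
    refine Submodule.subset_span ⟨I.mul_mem_left _ hxI, ⟨_, hh⟩, ?_⟩
    rw [leadPower_eq_degreeOf hd] at hxi
    rw [leadPower_eq_degreeOf hh]
    refine (degreeOf_mul_le _ _ _).trans ?_
    have h0 : degreeOf 0 (rename (Fin.succ : Fin r → Fin (r + 1)) (monomial u a)) = 0 := by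
      refine Nat.le_zero.mp (degreeOf_le_iff.mpr fun m hm => ?_)
      rw [rename_monomial] at hm
      have := Finset.mem_singleton.mp (support_monomial_subset hm)
      rw [this, Finsupp.mapDomain_of_notMem_range]
      rintro ⟨j, hj⟩
      exact Fin.succ_ne_zero j hj
    omega

/-- The `i`-th partial elimination ideal `K_i(I)`: the image of `K̃_i(I)` in `k[x_1, …, x_r]`
under `f ↦ f̄`. The variable `x_{j+1}` of `k[x_0, …, x_r]` is the variable number `j` of
`k[x_1, …, x_r]`. -/
def partialElimIdeal {r : ℕ} {k : Type*} [Field k] (i : ℕ)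
    (I : Ideal (MvPolynomial (Fin (r + 1)) k)) : Ideal (MvPolynomial (Fin r) k) where
  __ := ((partialElimAux i I).map (coeffXZero i)).toAddSubmonoid
  smul_mem' c x hx := by
    change c * x ∈ (partialElimAux i I).map (coeffXZero i)
    replace hx : x ∈ (partialElimAux i I).map (coeffXZero i) := hx
    obtain ⟨f, hf, rfl⟩ := hx
    induction c using MvPolynomial.induction_on' with
    | monomial u a =>
      rw [← coeffXZero_rename_mul]
      exact Submodule.mem_map_of_mem (rename_monomial_mul_mem i I u a hf)
    | add p q hp hq => rw [add_mul]; exact add_mem hp hq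

/-- `G_i = {f̄ | f ∈ G, d₀(f) = i}`. -/
def partialElimBasis {r : ℕ} {k : Type*} [Field k] (i : ℕ)
    (G : Set (MvPolynomial (Fin (r + 1)) k)) : Set (MvPolynomial (Fin r) k) :=
  coeffXZero i '' {f ∈ G | leadPower f = i}

end

/-!
A monomial `M` lies in `in(K_i(I))` precisely if `x_0 ^ i * M` lies in `in(I)`
(`monomial_mem_initialIdeal_partialElimIdeal_iff`): the `in(K_i(I))` are the slices of `in(I)`. This
uses only that `I` is homogeneous and that in a fixed degree the order compares exponents of `x_0`
first. Two facts about generic coordinates then carry the proposition, and both come from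
semicontinuity of rank. Fix an upper segment `T` of the monomials of one degree. The number of
monomials of `in(g(I))` in `T` is the rank of the projection of a graded piece of `g(I)` to the
coefficients at `T`, and the rank of such a family is lower semicontinuous in `g`. So its generic
value bounds the rank for every matrix, singular ones included (`card_le_card_filter_of_isGenericInitialIdeal`).

* Openness. If `in(I)` is generic, then each of these ranks is maximal at the identity, hence stays
  so near it. As `in(I)` is generated by finitely many monomials, `in(g(I)) = in(I)` on a Zariski
  neighbourhood of the identity (`InGenericCoordinates.exists_polynomial`). Such a neighbourhood
  meets the subgroup of matrices `diag(1, h)` in a nonempty open subset, and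
  `K_i(diag(1, h) I) = h K_i(I)`, so that `K_i(I)` is in generic coordinates.
* Strong stability. Suppose `M ∈ in(I)` involves `x_l` but `N = M * x_j / x_l`, with `j < l`, is not
  in `in(I)`. Apply `x_l ↦ x_l + s x_j` to elements of `I` whose leading monomials are `M` and the
  members of `in(I)` that are `≥ N`. Modulo monomials smaller than `N`, the image of the first
  element, divided by `s`, tends to a multiple of `N` as `s → 0`, a nonzero one in characteristic
  zero. The limits have distinct leading monomials, so for some `s ≠ 0` the rank exceeds its bound
  (`InGenericCoordinates.exchange_mem`).

Strong stability shows that a minimal generator `M` of `in(K_i(I))`, if `M ≠ 1` or `I` vanishes in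
degrees below `i`, yields a minimal generator `x_0 ^ i * M` of `in(I)` (`IsMinimalGenerator.cons`). Every minimal generator of `in(I)` is the
leading monomial of an element of a Gröbner basis, which gives the statement on Gröbner bases.
-/

open scoped MonomialOrder

/-! ### Initial ideals -/

section InitialIdeal

variable {σ k : Type*} [Field k]

theorem monomial_one_mem_of_le {J : Ideal (MvPolynomial σ k)} {N M : σ →₀ ℕ} (h : N ≤ M)
    (hN : monomial N (1 : k) ∈ J) : monomial M (1 : k) ∈ J := by
  have : monomial M (1 : k) = monomial (M - N) 1 * monomial N 1 := by
    rw [monomial_mul, tsub_add_cancel_of_le h, one_mul]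
  rw [this]
  exact J.mul_mem_left _ hN

theorem initialIdeal_eq_span_monomial (m : MonomialOrder σ) (I : Ideal (MvPolynomial σ k)) :
    initialIdeal m I =
      Ideal.span ((fun s => monomial s (1 : k)) '' (m.degree '' {f | f ∈ I ∧ f ≠ 0})) := by
  rw [initialIdeal, MonomialOrder.span_leadingTerm_eq_span_monomial', Set.image_image]
  congr 1

theorem monomial_degree_mem_initialIdeal (m : MonomialOrder σ) {I : Ideal (MvPolynomial σ k)}
    {f : MvPolynomial σ k} (hf : f ∈ I) (h0 : f ≠ 0) :
    monomial (m.degree f) (1 : k) ∈ initialIdeal m I := by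
  rw [initialIdeal_eq_span_monomial]
  exact Ideal.subset_span ⟨_, ⟨f, ⟨hf, h0⟩, rfl⟩, rfl⟩

theorem exists_degree_eq_of_monomial_mem_initialIdeal (m : MonomialOrder σ)
    {I : Ideal (MvPolynomial σ k)} {M : σ →₀ ℕ} (hM : monomial M (1 : k) ∈ initialIdeal m I) :
    ∃ f ∈ I, f ≠ 0 ∧ m.degree f = M := by
  rw [initialIdeal_eq_span_monomial, mem_ideal_span_monomial_image] at hM
  obtain ⟨_, ⟨f, ⟨hf, h0⟩, rfl⟩, hle⟩ := hM M (by classical simp [support_monomial])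
  have hmon : monomial (M - m.degree f) (1 : k) ≠ 0 := by simp
  refine ⟨monomial (M - m.degree f) 1 * f, I.mul_mem_left _ hf, mul_ne_zero hmon h0, ?_⟩
  classical
  rw [MonomialOrder.degree_mul hmon h0, MonomialOrder.degree_monomial, if_neg one_ne_zero,
    tsub_add_cancel_of_le hle]

/-- An initial ideal is determined by the monomials it contains. -/
theorem initialIdeal_le_of_monomial_mem (m : MonomialOrder σ) {I J : Ideal (MvPolynomial σ k)}
    (h : ∀ M, monomial M (1 : k) ∈ initialIdeal m I → monomial M (1 : k) ∈ J) :
    initialIdeal m I ≤ J := by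
  conv_lhs => rw [initialIdeal_eq_span_monomial]
  rw [Ideal.span_le]
  rintro _ ⟨_, ⟨f, ⟨hf, h0⟩, rfl⟩, rfl⟩
  exact h _ (monomial_degree_mem_initialIdeal m hf h0)

/-- By the Hilbert basis theorem, an initial ideal is generated by finitely many monomials. -/
theorem exists_finset_initialIdeal_eq_span [Finite σ] (m : MonomialOrder σ)
    (I : Ideal (MvPolynomial σ k)) :
    ∃ S : Finset (σ →₀ ℕ), (∀ M ∈ S, monomial M (1 : k) ∈ initialIdeal m I) ∧
      initialIdeal m I = Ideal.span ((fun s => monomial s (1 : k)) '' (S : Set (σ →₀ ℕ))) := by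
  classical
  have hfg : (initialIdeal m I).FG := IsNoetherian.noetherian _
  rw [initialIdeal_eq_span_monomial] at hfg
  obtain ⟨S', hS', hspan⟩ := (Submodule.fg_span_iff_fg_span_finset_subset _).mp hfg
  obtain ⟨S, hS, rfl⟩ := Finset.subset_set_image_iff.mp hS'
  refine ⟨S, fun M hM => ?_, ?_⟩
  · obtain ⟨f, ⟨hf, h0⟩, rfl⟩ := hS hM
    exact monomial_degree_mem_initialIdeal m hf h0
  · rw [initialIdeal_eq_span_monomial, Ideal.span, hspan, Finset.coe_image]

theorem MonomialOrder.degree_eq_of_support_le (m : MonomialOrder σ) {f : MvPolynomial σ k}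
    {M : σ →₀ ℕ} (hM : coeff M f ≠ 0) (h : ∀ u ∈ f.support, u ≼[m] M) : m.degree f = M :=
  m.toSyn.injective (le_antisymm (m.degree_le_iff.mpr h) (m.le_degree (mem_support_iff.mpr hM)))

theorem IsHomogeneous.degree_of_mem_support {f : MvPolynomial σ k} {d : ℕ}
    (hf : f.IsHomogeneous d) {u : σ →₀ ℕ} (hu : u ∈ f.support) : u.degree = d := by
  have := hf (mem_support_iff.mp hu)
  rw [Finsupp.degree_eq_weight_one]
  exact this

variable [LinearOrder σ] [WellFoundedGT σ]

theorem exists_homogeneous_of_monomial_mem_initialIdeal {I : Ideal (MvPolynomial σ k)}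
    (hI : I.IsHomogeneous (homogeneousSubmodule σ k)) {M : σ →₀ ℕ}
    (hM : monomial M (1 : k) ∈ initialIdeal MonomialOrder.degLex I) :
    ∃ f ∈ I, f.IsHomogeneous M.degree ∧ f ≠ 0 ∧ MonomialOrder.degLex.degree f = M := by
  obtain ⟨f, hf, h0, rfl⟩ := exists_degree_eq_of_monomial_mem_initialIdeal _ hM
  set M := MonomialOrder.degLex.degree f
  have hc : coeff M (homogeneousComponent M.degree f) ≠ 0 := by
    rw [coeff_homogeneousComponent, if_pos rfl]
    exact MonomialOrder.coeff_degree_ne_zero_iff.mpr h0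
  refine ⟨homogeneousComponent M.degree f, homogeneousComponent_mem_of_mem hI hf _,
    homogeneousComponent_isHomogeneous _ _, fun h => hc (by rw [h, coeff_zero]),
    MonomialOrder.degree_eq_of_support_le _ hc fun u hu => ?_⟩
  rw [support_homogeneousComponent, Finset.mem_filter] at hu
  exact MonomialOrder.degLex.le_degree hu.1

end InitialIdeal

/-! ### Linear independence under specialization of parameters -/

section Specialization

/-- Linear independence of finitely many vectors depending polynomially on parameters is an open
condition: if they are independent at one parameter value, then a single polynomial, nonzero at
that value, guarantees independence wherever it does not vanish. -/
theorem exists_ne_zero_forall_linearIndependent {k A ι κ : Type*} [Field k] [CommRing A]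
    [Algebra k A] [Fintype ι] [Fintype κ] (V : ι → κ → A) (ev : A →ₐ[k] k)
    (h : LinearIndependent k fun a b => ev (V a b)) :
    ∃ p : A, ev p ≠ 0 ∧
      ∀ ev' : A →ₐ[k] k, ev' p ≠ 0 → LinearIndependent k fun a b => ev' (V a b) := by
  classical
  let W (e : A →ₐ[k] k) : Matrix ι κ k := Matrix.of fun a b => e (V a b)
  obtain ⟨L, hL⟩ := LinearMap.exists_leftInverse_of_injective (W ev).vecMulLinear
    (LinearMap.ker_eq_bot.mpr (Matrix.vecMul_injective_iff.mpr h))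
  -- a right inverse of the matrix of the vectors at `ev`
  let B : Matrix κ ι k := Matrix.of fun b => L (Pi.single b 1)
  have hB : W ev * B = 1 := by
    ext a c
    have h1 := congrFun (LinearMap.congr_fun hL (Pi.single a 1)) c
    have h2 : W ev a = ∑ b, W ev a b • (Pi.single b 1 : κ → k) := by
      ext j; simp [Finset.sum_apply, Pi.single_apply]
    rw [LinearMap.comp_apply, Matrix.vecMulLinear_apply, Matrix.single_one_vecMul, Matrix.row,
      h2, map_sum] at h1
    simpa [Matrix.mul_apply, B, Matrix.one_apply, Pi.single_apply, eq_comm] using h1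
  have hdet (e : A →ₐ[k] k) :
      e (Matrix.of V * B.map (algebraMap k A)).det = (W e * B).det := by
    rw [AlgHom.map_det]
    congr 1
    ext a c
    simp [Matrix.mul_apply, W]
  refine ⟨(Matrix.of V * B.map (algebraMap k A)).det, by rw [hdet, hB]; simp, fun e he => ?_⟩
  rw [hdet] at he
  have hu : IsUnit (W e * B) := (Matrix.isUnit_iff_isUnit_det _).mpr (isUnit_iff_ne_zero.mpr he)
  have hinj := Matrix.vecMul_injective_of_isUnit hu
  refine (Matrix.vecMul_injective_iff (M := W e)).mp fun x y hxy => hinj ?_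
  simp only [← Matrix.vecMul_vecMul]
  exact congrArg (fun z => Matrix.vecMul z B) hxy

/-- Polynomials with distinct leading monomials are linearly independent, also when only the
coefficients at a set `T` of monomials containing the leading ones are recorded; `μ a` is the
largest monomial of `T` occurring in `h a`. -/
theorem linearIndependent_coeff_of_injective {σ k ι : Type*} [Field k] [Fintype ι]
    (m : MonomialOrder σ) (T : Finset (σ →₀ ℕ)) (h : ι → MvPolynomial σ k) (μ : ι → σ →₀ ℕ)
    (hμ : Function.Injective μ) (hT : ∀ a, μ a ∈ T) (hne : ∀ a, coeff (μ a) (h a) ≠ 0)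
    (hlt : ∀ a, ∀ t ∈ T, μ a ≺[m] t → coeff t (h a) = 0) :
    LinearIndependent k fun a (t : T) => coeff (t : σ →₀ ℕ) (h a) := by
  classical
  rw [Fintype.linearIndependent_iff]
  by_contra! hcon
  obtain ⟨c, hc, i, hi⟩ := hcon
  obtain ⟨a, ha, hmax⟩ := Finset.exists_max_image (Finset.univ.filter fun a => c a ≠ 0)
    (fun a => m.toSyn (μ a)) ⟨i, by simpa using hi⟩
  have h1 := congrFun hc ⟨μ a, hT a⟩
  rw [Finset.sum_apply, Finset.sum_eq_single a] at h1
  · exact mul_ne_zero (by simpa using ha) (hne a) h1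
  · intro b _ hba
    by_cases hb : c b = 0
    · simp [hb]
    · have hle := hmax b (by simpa using hb)
      have hlt' := lt_of_le_of_ne hle fun he => hba (hμ (m.toSyn.injective he))
      simp [hlt b _ (hT a) hlt']
  · simp

end Specialization

/-! ### Linear substitutions and the rank bound for generic initial ideals -/

section LinearSubstitution

variable {n : ℕ} {k : Type*} [Field k]

/-- The substitution `x_j ↦ ∑ i, A i j • x_i` attached to an arbitrary, possibly singular, matrix
with entries in a `k`-algebra `R`. -/
noncomputable def linSubst {R : Type*} [CommRing R] [Algebra k R] (A : Matrix (Fin n) (Fin n) R) :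
    MvPolynomial (Fin n) k →ₐ[k] MvPolynomial (Fin n) R :=
  aeval fun j => ∑ i, C (A i j) * X i

theorem coordChange_eq_linSubst (g : GL (Fin n) k) :
    coordChange g = linSubst (g : Matrix (Fin n) (Fin n) k) := rfl

theorem linSubst_isHomogeneous (A : Matrix (Fin n) (Fin n) k) {f : MvPolynomial (Fin n) k} {d : ℕ}
    (hf : f.IsHomogeneous d) : (linSubst A f).IsHomogeneous d := by
  have h := hf.aeval (fun j => ∑ i, C (A i j) * X i : Fin n → MvPolynomial (Fin n) k) (n := 1)
    fun j => IsHomogeneous.sum _ _ _ fun i _ => by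
      simpa using (isHomogeneous_C _ (A i j)).mul (isHomogeneous_X k i)
  rw [one_mul] at h
  exact h

theorem map_linSubst {R S : Type*} [CommRing R] [Algebra k R] [CommRing S] [Algebra k S]
    (e : R →ₐ[k] S) (A : Matrix (Fin n) (Fin n) R) (f : MvPolynomial (Fin n) k) :
    MvPolynomial.map (e : R →+* S) (linSubst A f) = linSubst (A.map e) f := by
  induction f using MvPolynomial.induction_on with
  | C a =>
    simp only [linSubst, MvPolynomial.algHom_C, MvPolynomial.algebraMap_apply, map_C]
    simp
  | add p q hp hq => simp only [map_add, hp, hq]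
  | mul_X p j hp => simp only [map_mul, hp]; simp [linSubst]

theorem map_coeff_linSubst {R S : Type*} [CommRing R] [Algebra k R] [CommRing S] [Algebra k S]
    (e : R →ₐ[k] S) (A : Matrix (Fin n) (Fin n) R) (f : MvPolynomial (Fin n) k) (t : Fin n →₀ ℕ) :
    e (coeff t (linSubst A f)) = coeff t (linSubst (A.map e) f) := by
  rw [← map_linSubst, coeff_map]
  rfl

theorem linSubst_one (f : MvPolynomial (Fin n) k) :
    linSubst (1 : Matrix (Fin n) (Fin n) k) f = f := by
  have : linSubst (1 : Matrix (Fin n) (Fin n) k) = AlgHom.id k _ := by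
    ext j
    simp [linSubst, Matrix.one_apply]
  rw [this]
  rfl

theorem linSubst_linSubst (A B : Matrix (Fin n) (Fin n) k) (f : MvPolynomial (Fin n) k) :
    linSubst A (linSubst B f) = linSubst (A * B) f := by
  have : (linSubst A).comp (linSubst B) = linSubst (k := k) (A * B) := by
    refine MvPolynomial.algHom_ext fun j => ?_
    simp only [linSubst, AlgHom.comp_apply, aeval_X, map_sum, map_mul, algHom_C, Matrix.mul_apply,
      MvPolynomial.algebraMap_eq, Finset.mul_sum, Finset.sum_mul]
    rw [Finset.sum_comm]
    refine Finset.sum_congr rfl fun i _ => Finset.sum_congr rfl fun l _ => ?_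
    ring
  rw [← this]
  rfl

theorem mem_transform_iff {g : GL (Fin n) k} {I : Ideal (MvPolynomial (Fin n) k)}
    {f : MvPolynomial (Fin n) k} : f ∈ transform g I ↔ ∃ f' ∈ I, coordChange g f' = f := by
  refine Ideal.mem_map_iff_of_surjective (coordChange g) fun f => ⟨coordChange g⁻¹ f, ?_⟩
  rw [coordChange_eq_linSubst, coordChange_eq_linSubst, linSubst_linSubst, ← Units.val_mul,
    mul_inv_cancel, Units.val_one, linSubst_one]

theorem coordChange_inv_coordChange (g : GL (Fin n) k) (f : MvPolynomial (Fin n) k) :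
    coordChange g⁻¹ (coordChange g f) = f := by
  rw [coordChange_eq_linSubst, coordChange_eq_linSubst, linSubst_linSubst, ← Units.val_mul,
    inv_mul_cancel, Units.val_one, linSubst_one]

theorem transform_isHomogeneous {I : Ideal (MvPolynomial (Fin n) k)}
    (hI : I.IsHomogeneous (homogeneousSubmodule (Fin n) k)) (g : GL (Fin n) k) :
    (transform g I).IsHomogeneous (homogeneousSubmodule (Fin n) k) := by
  obtain ⟨S, hS⟩ := (Ideal.IsHomogeneous.iff_exists _ _).mp hI
  rw [transform, hS, Ideal.map_span]
  refine Ideal.homogeneous_span _ _ ?_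
  rintro _ ⟨_, ⟨⟨f, d, hf⟩, _, rfl⟩, rfl⟩
  exact ⟨d, linSubst_isHomogeneous _ hf⟩

open scoped Classical in
/-- If homogeneous elements of `I` stay independent when only their coefficients at `T` are
recorded, there are at most as many of them as there are monomials of `in(I)` in `T`. -/
theorem card_le_card_filter_of_linearIndependent_coeff {T : Finset (Fin n →₀ ℕ)}
    (hT : ∀ u ∈ T, ∀ v : Fin n →₀ ℕ, v.degree = u.degree →
      u ≼[MonomialOrder.degLex] v → v ∈ T)
    {I : Ideal (MvPolynomial (Fin n) k)} {d : ℕ} {ι : Type*} [Fintype ι]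
    (f : ι → MvPolynomial (Fin n) k) (hfI : ∀ a, f a ∈ I) (hfd : ∀ a, (f a).IsHomogeneous d)
    (h : LinearIndependent k fun a (t : T) => coeff (t : Fin n →₀ ℕ) (f a)) :
    Fintype.card ι ≤
      (T.filter fun t => monomial t (1 : k) ∈ initialIdeal MonomialOrder.degLex I).card := by
  set S := T.filter fun t => monomial t (1 : k) ∈ initialIdeal MonomialOrder.degLex I with hS
  -- the coefficients at `S` alone already separate the span of the `f a`
  have hind : LinearIndependent k fun a (t : S) => coeff (t : Fin n →₀ ℕ) (f a) := by
    rw [Fintype.linearIndependent_iff] at h ⊢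
    intro c hc
    refine h c ?_
    set F := ∑ a, c a • f a with hF
    have hFI : F ∈ I := sum_mem fun a _ => by
      rw [smul_eq_C_mul]; exact I.mul_mem_left _ (hfI a)
    have hFd : F.IsHomogeneous d := IsHomogeneous.sum _ _ _ fun a _ => by
      rw [smul_eq_C_mul]; simpa using (isHomogeneous_C _ (c a)).mul (hfd a)
    ext ⟨t, ht⟩
    have hcoeff (t : Fin n →₀ ℕ) : coeff t F = ∑ a, c a * coeff t (f a) := by
      simp [hF, coeff_sum]
    by_contra hne
    have hne' : coeff t F ≠ 0 := by
      rw [hcoeff]; simpa [Finset.sum_apply] using hne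
    have hF0 : F ≠ 0 := fun h0 => hne' (by rw [h0, coeff_zero])
    have hlead := MonomialOrder.degLex.degree_mem_support hF0
    have hmem : MonomialOrder.degLex.degree F ∈ S := by
      rw [hS, Finset.mem_filter]
      refine ⟨hT t ht _ ?_ (MonomialOrder.degLex.le_degree (mem_support_iff.mpr hne')),
        monomial_degree_mem_initialIdeal _ hFI hF0⟩
      rw [IsHomogeneous.degree_of_mem_support hFd hlead,
        IsHomogeneous.degree_of_mem_support hFd (mem_support_iff.mpr hne')]
    have := congrFun hc ⟨_, hmem⟩
    refine mem_support_iff.mp hlead ?_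
    rw [hcoeff]
    simpa [Finset.sum_apply] using this
  simpa using hind.fintype_card_le_finrank

/-- A nonempty Zariski open set meets the nonvanishing locus of every nonzero polynomial. -/
theorem IsZariskiOpen.exists_mem_eval_ne_zero [Infinite k] {U : Set (GL (Fin n) k)}
    (hU : IsZariskiOpen U) (hne : U.Nonempty) {p : MvPolynomial (Fin n × Fin n) k} (hp : p ≠ 0) :
    ∃ g ∈ U, eval (fun ij => (g : Matrix (Fin n) (Fin n) k) ij.1 ij.2) p ≠ 0 := by
  obtain ⟨S, rfl⟩ := hU
  obtain ⟨g₁, q, hq, hq1⟩ := hne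
  have hq0 : q ≠ 0 := fun h => hq1 (by rw [h, map_zero])
  by_contra! hcon
  refine mul_ne_zero hp hq0 (eq_of_eval_eq_on_gl fun g => ?_)
  rw [map_mul, map_zero, mul_eq_zero]
  by_contra! hg
  exact hg.1 (hcon g ⟨q, hq, hg.2⟩)

/-- Independence of the `T`-coefficients of substituted polynomials is a Zariski open condition on
the substitution matrix. -/
theorem exists_polynomial_forall_linearIndependent_coeff (T : Finset (Fin n →₀ ℕ)) {ι : Type*}
    [Fintype ι] (f : ι → MvPolynomial (Fin n) k) (A : Matrix (Fin n) (Fin n) k)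
    (hA : LinearIndependent k fun a (t : T) => coeff (t : Fin n →₀ ℕ) (linSubst A (f a))) :
    ∃ p : MvPolynomial (Fin n × Fin n) k, eval (fun ij => A ij.1 ij.2) p ≠ 0 ∧
      ∀ B : Matrix (Fin n) (Fin n) k, eval (fun ij => B ij.1 ij.2) p ≠ 0 →
        LinearIndependent k fun a (t : T) => coeff (t : Fin n →₀ ℕ) (linSubst B (f a)) := by
  let V : ι → T → MvPolynomial (Fin n × Fin n) k := fun a t =>
    coeff (t : Fin n →₀ ℕ) (linSubst (Matrix.mvPolynomialX (Fin n) (Fin n) k) (f a))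
  have hV (B : Matrix (Fin n) (Fin n) k) (a : ι) (t : T) :
      aeval (fun ij : Fin n × Fin n => B ij.1 ij.2) (V a t) =
        coeff (t : Fin n →₀ ℕ) (linSubst B (f a)) := by
    rw [map_coeff_linSubst]
    congr 3
    ext i j
    simp
  obtain ⟨p, hp, hp'⟩ := exists_ne_zero_forall_linearIndependent V
    (aeval fun ij : Fin n × Fin n => A ij.1 ij.2) (by simpa only [hV] using hA)
  refine ⟨p, hp, fun B hB => ?_⟩
  simpa only [hV] using hp' (aeval fun ij : Fin n × Fin n => B ij.1 ij.2) hB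

open scoped Classical in
/-- No linear substitution, invertible or not, makes the leading part of a homogeneous ideal larger
than its generic initial ideal: rank is lower semicontinuous, and `IsGenericInitialIdeal` fixes its
value on a dense set. -/
theorem card_le_card_filter_of_isGenericInitialIdeal [Infinite k] {T : Finset (Fin n →₀ ℕ)}
    (hT : ∀ u ∈ T, ∀ v : Fin n →₀ ℕ, v.degree = u.degree →
      u ≼[MonomialOrder.degLex] v → v ∈ T)
    {I J : Ideal (MvPolynomial (Fin n) k)}
    (hJ : IsGenericInitialIdeal MonomialOrder.degLex I J) {d : ℕ} {ι : Type*} [Fintype ι]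
    (f : ι → MvPolynomial (Fin n) k) (hfI : ∀ a, f a ∈ I) (hfd : ∀ a, (f a).IsHomogeneous d)
    (A : Matrix (Fin n) (Fin n) k)
    (hA : LinearIndependent k fun a (t : T) => coeff (t : Fin n →₀ ℕ) (linSubst A (f a))) :
    Fintype.card ι ≤ (T.filter fun t => monomial t (1 : k) ∈ J).card := by
  obtain ⟨p, hp, hp'⟩ := exists_polynomial_forall_linearIndependent_coeff T f A hA
  obtain ⟨U, hU, hne, hUJ⟩ := hJ
  obtain ⟨g, hgU, hg⟩ := hU.exists_mem_eval_ne_zero hne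
    (p := p) (fun h => hp (by rw [h, map_zero]))
  rw [← hUJ g hgU]
  exact card_le_card_filter_of_linearIndependent_coeff hT (fun a => coordChange g (f a))
    (fun a => mem_transform_iff.mpr ⟨f a, hfI a, rfl⟩)
    (fun a => linSubst_isHomogeneous _ (hfd a)) (hp' _ hg)

end LinearSubstitution

/-! ### The locus where the initial ideal is generic is open -/

section Openness

variable {n : ℕ} {k : Type*} [Field k]

theorem mem_finsuppAntidiag_univ_iff {d : ℕ} {u : Fin n →₀ ℕ} :
    u ∈ (Finset.univ : Finset (Fin n)).finsuppAntidiag d ↔ u.degree = d := by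
  simp [Finset.mem_finsuppAntidiag, Finsupp.degree_eq_sum]

open scoped Classical in
/-- The monomials of the same degree as `x ^ N` that are at least `x ^ N`. -/
noncomputable def monomialsGE (N : Fin n →₀ ℕ) : Finset (Fin n →₀ ℕ) :=
  (Finset.univ.finsuppAntidiag N.degree).filter fun u => N ≼[MonomialOrder.degLex] u

open scoped Classical in
/-- The monomials of the same degree as `x ^ N` that are greater than `x ^ N`. -/
noncomputable def monomialsGT (N : Fin n →₀ ℕ) : Finset (Fin n →₀ ℕ) :=
  (Finset.univ.finsuppAntidiag N.degree).filter fun u => N ≺[MonomialOrder.degLex] u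

theorem mem_monomialsGE {N u : Fin n →₀ ℕ} :
    u ∈ monomialsGE N ↔ u.degree = N.degree ∧ N ≼[MonomialOrder.degLex] u := by
  classical
  rw [monomialsGE, Finset.mem_filter, mem_finsuppAntidiag_univ_iff]

theorem mem_monomialsGT {N u : Fin n →₀ ℕ} :
    u ∈ monomialsGT N ↔ u.degree = N.degree ∧ N ≺[MonomialOrder.degLex] u := by
  classical
  rw [monomialsGT, Finset.mem_filter, mem_finsuppAntidiag_univ_iff]

theorem monomialsGE_upward (N : Fin n →₀ ℕ) : ∀ u ∈ monomialsGE N, ∀ v : Fin n →₀ ℕ,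
    v.degree = u.degree → u ≼[MonomialOrder.degLex] v → v ∈ monomialsGE N := by
  intro u hu v hv huv
  rw [mem_monomialsGE] at hu ⊢
  exact ⟨hv.trans hu.1, hu.2.trans huv⟩

theorem monomialsGT_upward (N : Fin n →₀ ℕ) : ∀ u ∈ monomialsGT N, ∀ v : Fin n →₀ ℕ,
    v.degree = u.degree → u ≼[MonomialOrder.degLex] v → v ∈ monomialsGT N := by
  intro u hu v hv huv
  rw [mem_monomialsGT] at hu ⊢
  exact ⟨hv.trans hu.1, hu.2.trans_le huv⟩

/-- Elements of an ideal realizing the monomials of its initial ideal as leading monomials have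
independent `T`-coefficients. -/
theorem linearIndependent_coeff_of_degree_eq {T S : Finset (Fin n →₀ ℕ)} (hST : S ⊆ T)
    (f : S → MvPolynomial (Fin n) k) (h0 : ∀ a, f a ≠ 0)
    (hdeg : ∀ a, MonomialOrder.degLex.degree (f a) = a) :
    LinearIndependent k fun a (t : T) => coeff (t : Fin n →₀ ℕ) (f a) := by
  refine linearIndependent_coeff_of_injective MonomialOrder.degLex T f (fun a => a)
    Subtype.val_injective (fun a => hST a.2) (fun a => ?_) fun a t _ hlt => ?_
  · have := MonomialOrder.degLex.coeff_degree_ne_zero_iff.mpr (h0 a)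
    rwa [hdeg] at this
  · exact MonomialOrder.degLex.coeff_eq_zero_of_lt (by rwa [hdeg])

open scoped Classical in
/-- No coordinate change makes the part of the initial ideal in an upper segment `T` of a degree
larger than it is generically. -/
theorem card_filter_initialIdeal_transform_le [Infinite k] {T : Finset (Fin n →₀ ℕ)} {d : ℕ}
    (hTd : ∀ u ∈ T, u.degree = d)
    (hT : ∀ u ∈ T, ∀ v : Fin n →₀ ℕ, v.degree = u.degree →
      u ≼[MonomialOrder.degLex] v → v ∈ T)
    {I J : Ideal (MvPolynomial (Fin n) k)}
    (hI : I.IsHomogeneous (homogeneousSubmodule (Fin n) k))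
    (hJ : IsGenericInitialIdeal MonomialOrder.degLex I J) (g : GL (Fin n) k) :
    (T.filter fun t =>
      monomial t (1 : k) ∈ initialIdeal MonomialOrder.degLex (transform g I)).card ≤
      (T.filter fun t => monomial t (1 : k) ∈ J).card := by
  have hex : ∀ a : {t // t ∈ T.filter fun t =>
      monomial t (1 : k) ∈ initialIdeal MonomialOrder.degLex (transform g I)},
      ∃ f ∈ transform g I, f.IsHomogeneous d ∧ f ≠ 0 ∧ MonomialOrder.degLex.degree f = a := by
    rintro ⟨t, ht⟩
    rw [Finset.mem_filter] at ht
    obtain ⟨f, hf⟩ :=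
      exists_homogeneous_of_monomial_mem_initialIdeal (transform_isHomogeneous hI g) ht.2
    rw [hTd t ht.1] at hf
    exact ⟨f, hf⟩
  choose h hgI hd h0 hdeg using hex
  have hinv (a) : linSubst (g : Matrix (Fin n) (Fin n) k) (coordChange g⁻¹ (h a)) = h a := by
    have := coordChange_inv_coordChange g⁻¹ (h a)
    rwa [inv_inv] at this
  have hmem (a) : coordChange g⁻¹ (h a) ∈ I := by
    obtain ⟨f, hf, hfa⟩ := mem_transform_iff.mp (hgI a)
    rwa [← hfa, coordChange_inv_coordChange]
  have := card_le_card_filter_of_isGenericInitialIdeal hT hJ (fun a => coordChange g⁻¹ (h a))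
    hmem (fun a => linSubst_isHomogeneous _ (hd a)) g (by
      simp only [hinv]
      exact linearIndependent_coeff_of_degree_eq (Finset.filter_subset _ _) h h0 hdeg)
  simpa only [Fintype.card_coe] using this

open scoped Classical in
/-- The part of the initial ideal in an upper segment `T` of a degree cannot become smaller under
coordinate changes close to the identity. -/
theorem exists_polynomial_card_filter_initialIdeal_le {T : Finset (Fin n →₀ ℕ)} {d : ℕ}
    (hTd : ∀ u ∈ T, u.degree = d)
    (hT : ∀ u ∈ T, ∀ v : Fin n →₀ ℕ, v.degree = u.degree →
      u ≼[MonomialOrder.degLex] v → v ∈ T)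
    {I : Ideal (MvPolynomial (Fin n) k)}
    (hI : I.IsHomogeneous (homogeneousSubmodule (Fin n) k)) :
    ∃ p : MvPolynomial (Fin n × Fin n) k,
      eval (fun ij => (1 : Matrix (Fin n) (Fin n) k) ij.1 ij.2) p ≠ 0 ∧
      ∀ g : GL (Fin n) k, eval (fun ij => (g : Matrix (Fin n) (Fin n) k) ij.1 ij.2) p ≠ 0 →
        (T.filter fun t => monomial t (1 : k) ∈ initialIdeal MonomialOrder.degLex I).card ≤
          (T.filter fun t =>
            monomial t (1 : k) ∈ initialIdeal MonomialOrder.degLex (transform g I)).card := by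
  have hex : ∀ a : {t // t ∈ T.filter fun t =>
      monomial t (1 : k) ∈ initialIdeal MonomialOrder.degLex I},
      ∃ f ∈ I, f.IsHomogeneous d ∧ f ≠ 0 ∧ MonomialOrder.degLex.degree f = a := by
    rintro ⟨t, ht⟩
    rw [Finset.mem_filter] at ht
    obtain ⟨f, hf⟩ := exists_homogeneous_of_monomial_mem_initialIdeal hI ht.2
    rw [hTd t ht.1] at hf
    exact ⟨f, hf⟩
  choose h hI' hd h0 hdeg using hex
  obtain ⟨p, hp, hp'⟩ := exists_polynomial_forall_linearIndependent_coeff T h 1 (by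
    simp only [linSubst_one]
    exact linearIndependent_coeff_of_degree_eq (Finset.filter_subset _ _) h h0 hdeg)
  refine ⟨p, hp, fun g hg => ?_⟩
  have := card_le_card_filter_of_linearIndependent_coeff hT (fun a => coordChange g (h a))
    (fun a => mem_transform_iff.mpr ⟨h a, hI' a, rfl⟩)
    (fun a => linSubst_isHomogeneous _ (hd a)) (hp' _ hg)
  simpa only [Fintype.card_coe] using this

/-- If `in(I)` is the generic initial ideal, then `in(g(I)) = in(I)` on a Zariski neighbourhood of
the identity, and not merely on some nonempty open set that may miss a given subgroup. -/
theorem InGenericCoordinates.exists_polynomial [Infinite k] {I : Ideal (MvPolynomial (Fin n) k)}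
    (hI : I.IsHomogeneous (homogeneousSubmodule (Fin n) k))
    (hgen : InGenericCoordinates MonomialOrder.degLex I) :
    ∃ p : MvPolynomial (Fin n × Fin n) k,
      eval (fun ij => (1 : Matrix (Fin n) (Fin n) k) ij.1 ij.2) p ≠ 0 ∧
      ∀ g : GL (Fin n) k, eval (fun ij => (g : Matrix (Fin n) (Fin n) k) ij.1 ij.2) p ≠ 0 →
        initialIdeal MonomialOrder.degLex (transform g I) =
          initialIdeal MonomialOrder.degLex I := by
  classical
  obtain ⟨S, hS, hspan⟩ := exists_finset_initialIdeal_eq_span MonomialOrder.degLex I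
  have hex (N : Fin n →₀ ℕ) := exists_polynomial_card_filter_initialIdeal_le (T := monomialsGE N)
    (fun u hu => (mem_monomialsGE.mp hu).1) (monomialsGE_upward N) hI
  choose p hp hp' using hex
  refine ⟨∏ N ∈ S, p N, by rw [map_prod]; exact Finset.prod_ne_zero_iff.mpr fun N _ => hp N,
    fun g hg => ?_⟩
  rw [map_prod, Finset.prod_ne_zero_iff] at hg
  have hle : initialIdeal MonomialOrder.degLex I ≤
      initialIdeal MonomialOrder.degLex (transform g I) := by
    conv_lhs => rw [hspan]
    rw [Ideal.span_le]
    rintro _ ⟨N, hN, rfl⟩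
    -- compare the monomials `≥ N` with the monomials `> N` in both initial ideals
    by_contra hcon
    have h1 := hp' N g (hg N hN)
    have h2 := card_filter_initialIdeal_transform_le (T := monomialsGT N)
      (fun u hu => (mem_monomialsGT.mp hu).1) (monomialsGT_upward N) hI hgen g
    have h3 : ((monomialsGE N).filter fun t =>
        monomial t (1 : k) ∈ initialIdeal MonomialOrder.degLex (transform g I)) ⊆
        (monomialsGT N).filter fun t =>
        monomial t (1 : k) ∈ initialIdeal MonomialOrder.degLex (transform g I) := by
      intro t ht
      rw [Finset.mem_filter, mem_monomialsGE] at ht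
      rw [Finset.mem_filter, mem_monomialsGT]
      refine ⟨⟨ht.1.1, lt_of_le_of_ne ht.1.2 fun he => hcon ?_⟩, ht.2⟩
      rw [MonomialOrder.degLex.toSyn.injective he]
      exact ht.2
    have h4 : ((monomialsGT N).filter fun t =>
        monomial t (1 : k) ∈ initialIdeal MonomialOrder.degLex I).card <
        ((monomialsGE N).filter fun t =>
        monomial t (1 : k) ∈ initialIdeal MonomialOrder.degLex I).card := by
      refine Finset.card_lt_card ((Finset.ssubset_iff_of_subset fun t ht => ?_).mpr ⟨N, ?_, ?_⟩)
      · rw [Finset.mem_filter, mem_monomialsGT] at ht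
        rw [Finset.mem_filter, mem_monomialsGE]
        exact ⟨⟨ht.1.1, ht.1.2.le⟩, ht.2⟩
      · rw [Finset.mem_filter, mem_monomialsGE]
        exact ⟨⟨rfl, le_rfl⟩, hS N hN⟩
      · rw [Finset.mem_filter, mem_monomialsGT]
        exact fun h => lt_irrefl _ h.1.2
    have := Finset.card_le_card h3
    omega
  refine le_antisymm (initialIdeal_le_of_monomial_mem _ fun M hM => ?_) hle
  -- both initial ideals contain equally many monomials of each degree
  have h1 := card_filter_initialIdeal_transform_le
    (T := Finset.univ.finsuppAntidiag M.degree) (fun u hu => mem_finsuppAntidiag_univ_iff.mp hu)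
    (fun u hu v hv _ => mem_finsuppAntidiag_univ_iff.mpr
      (hv.trans (mem_finsuppAntidiag_univ_iff.mp hu))) hI hgen g
  have h2 := Finset.eq_of_subset_of_card_le
    (Finset.monotone_filter_right _ fun t _ (ht : monomial t (1 : k) ∈ _) => hle ht) h1
  have h3 : M ∈ (Finset.univ.finsuppAntidiag M.degree).filter fun t =>
      monomial t (1 : k) ∈ initialIdeal MonomialOrder.degLex (transform g I) :=
    Finset.mem_filter.mpr ⟨mem_finsuppAntidiag_univ_iff.mpr rfl, hM⟩
  rw [← h2] at h3
  exact (Finset.mem_filter.mp h3).2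

end Openness

/-! ### Strong stability of generic initial ideals in characteristic zero -/

section Stability

variable {n : ℕ} {k : Type*} [Field k]

/-- The matrix, with entries in `k[s]`, of the substitution `x_l ↦ x_l + s x_j` fixing the other
variables. -/
noncomputable def shearMatrix (k : Type*) [Field k] (j l : Fin n) :
    Matrix (Fin n) (Fin n) (Polynomial k) :=
  1 + Matrix.single j l Polynomial.X

theorem linSubst_shearMatrix_X (j l i : Fin n) :
    linSubst (k := k) (shearMatrix k j l) (X i) =
      X i + C Polynomial.X * (if i = l then X j else 0) := by
  classical
  simp only [linSubst, shearMatrix, aeval_X, Matrix.add_apply, map_add, add_mul,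
    Finset.sum_add_distrib, Matrix.one_apply, Matrix.single_apply]
  congr 1
  · simp
  · by_cases h : i = l
    · subst h
      simp [apply_ite (C : Polynomial k →+* _), ite_mul]
    · simp [h, Ne.symm h]

/-- Taylor expansion to first order of the substitution `x_l ↦ x_l + s x_j` in `s`. -/
theorem exists_linSubst_shearMatrix_eq (j l : Fin n) (f : MvPolynomial (Fin n) k) :
    ∃ h : MvPolynomial (Fin n) (Polynomial k),
      linSubst (shearMatrix k j l) f = MvPolynomial.map Polynomial.C f +
        C Polynomial.X * MvPolynomial.map Polynomial.C (X j * pderiv l f) +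
        C Polynomial.X ^ 2 * h := by
  classical
  induction f using MvPolynomial.induction_on with
  | C a => exact ⟨0, by simp [linSubst, MvPolynomial.algebraMap_apply]⟩
  | add p q hp hq =>
    obtain ⟨h₁, e₁⟩ := hp
    obtain ⟨h₂, e₂⟩ := hq
    refine ⟨h₁ + h₂, ?_⟩
    rw [map_add, e₁, e₂]
    simp only [map_add, map_mul, mul_add]
    ring
  | mul_X p i hp =>
    obtain ⟨h, e⟩ := hp
    rw [map_mul, e, linSubst_shearMatrix_X, Derivation.leibniz, pderiv_X]
    by_cases hil : i = l
    · subst hil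
      refine ⟨h * (X i + C Polynomial.X * X j) +
        MvPolynomial.map Polynomial.C (X j * pderiv i p) * X j, ?_⟩
      simp only [if_true, Pi.single_eq_same, smul_eq_mul, map_add, map_mul, map_X, map_one]
      ring
    · refine ⟨h * X i, ?_⟩
      simp only [if_neg hil, Pi.single_eq_of_ne hil, smul_eq_mul, map_add, map_mul, map_X,
        map_zero]
      ring

theorem coeff_linSubst_shearMatrix {j l : Fin n} {f : MvPolynomial (Fin n) k}
    {h : MvPolynomial (Fin n) (Polynomial k)}
    (e : linSubst (shearMatrix k j l) f = MvPolynomial.map Polynomial.C f +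
        C Polynomial.X * MvPolynomial.map Polynomial.C (X j * pderiv l f) +
        C Polynomial.X ^ 2 * h) (t : Fin n →₀ ℕ) :
    coeff t (linSubst (shearMatrix k j l) f) = Polynomial.C (coeff t f) +
      Polynomial.X * (Polynomial.C (coeff t (X j * pderiv l f)) + Polynomial.X * coeff t h) := by
  rw [e, ← C_pow, coeff_add, coeff_add, coeff_C_mul, coeff_C_mul, coeff_map, coeff_map]
  ring

theorem shearMatrix_map_aeval_zero (j l : Fin n) :
    (shearMatrix k j l).map (Polynomial.aeval (0 : k)) = 1 := by
  ext a b
  simp only [shearMatrix, Matrix.map_apply, Matrix.add_apply, Matrix.one_apply,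
    Matrix.single_apply, map_add]
  split_ifs <;> simp

/-- With the next lemma: if the leading monomial `M` of `f` involves `x_l`, then the leading
monomial of `x_j ∂_l f` is `M * x_j / x_l`. The coefficient there is a positive integer multiple of
that of `M` in `f`, which is where characteristic zero enters. -/
theorem coeff_X_mul_pderiv_ne_zero [CharZero k] {j l : Fin n} {f : MvPolynomial (Fin n) k}
    {M : Fin n →₀ ℕ} (hf : coeff M f ≠ 0) (hl : M l ≠ 0) :
    coeff (M - Finsupp.single l 1 + Finsupp.single j 1) (X j * pderiv l f) ≠ 0 := by
  rw [add_comm, coeff_X_mul, coeff_pderiv,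
    tsub_add_cancel_of_le (Finsupp.single_le_iff.mpr (Nat.one_le_iff_ne_zero.mpr hl))]
  exact mul_ne_zero hf (Nat.cast_add_one_ne_zero _)

theorem coeff_X_mul_pderiv_eq_zero_of_lt {j l : Fin n} {f : MvPolynomial (Fin n) k} {t : Fin n →₀ ℕ}
    (hl : MonomialOrder.degLex.degree f l ≠ 0)
    (ht : (MonomialOrder.degLex.degree f - Finsupp.single l 1 + Finsupp.single j 1)
      ≺[MonomialOrder.degLex] t) :
    coeff t (X j * pderiv l f) = 0 := by
  classical
  rw [coeff_X_mul']
  split_ifs with hj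
  · rw [coeff_pderiv, MonomialOrder.degLex.coeff_eq_zero_of_lt, zero_mul]
    set M := MonomialOrder.degLex.degree f
    have h1 : M - Finsupp.single l 1 + Finsupp.single l 1 = M :=
      tsub_add_cancel_of_le (Finsupp.single_le_iff.mpr (Nat.one_le_iff_ne_zero.mpr hl))
    have h2 : t - Finsupp.single j 1 + Finsupp.single j 1 = t :=
      tsub_add_cancel_of_le (Finsupp.single_le_iff.mpr
        (Nat.one_le_iff_ne_zero.mpr (Finsupp.mem_support_iff.mp hj)))
    rw [← h2, map_add, map_add, add_lt_add_iff_right] at ht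
    rw [← h1, map_add, map_add]
    simpa using ht
  · rfl

/-- Strong stability: in characteristic zero, a generic initial ideal containing a monomial
divisible by `x_l` contains the monomial in which one `x_l` is replaced by a larger variable. -/
theorem InGenericCoordinates.exchange_mem [CharZero k] {I : Ideal (MvPolynomial (Fin n) k)}
    (hI : I.IsHomogeneous (homogeneousSubmodule (Fin n) k))
    (hgen : InGenericCoordinates MonomialOrder.degLex I) {j l : Fin n} (hjl : j < l)
    {M : Fin n →₀ ℕ} (hM : monomial M (1 : k) ∈ initialIdeal MonomialOrder.degLex I)
    (hl : M l ≠ 0) :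
    monomial (M - Finsupp.single l 1 + Finsupp.single j 1) (1 : k) ∈
      initialIdeal MonomialOrder.degLex I := by
  classical
  obtain ⟨f₀, hf₀I, hf₀d, hf₀0, rfl⟩ := exists_homogeneous_of_monomial_mem_initialIdeal hI hM
  set M := MonomialOrder.degLex.degree f₀
  set N := M - Finsupp.single l 1 + Finsupp.single j 1 with hNdef
  have h1 : M - Finsupp.single l 1 + Finsupp.single l 1 = M :=
    tsub_add_cancel_of_le (Finsupp.single_le_iff.mpr (Nat.one_le_iff_ne_zero.mpr hl))
  have hNd : N.degree = M.degree := by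
    rw [← h1, hNdef, map_add, map_add, Finsupp.degree_single, Finsupp.degree_single]
  have hMN : M ≺[MonomialOrder.degLex] N := by
    rw [← h1, hNdef, map_add, map_add]
    exact (add_lt_add_iff_left _).mpr (MonomialOrder.degLex_single_lt_iff.mpr hjl)
  by_contra hN
  set T := monomialsGE N
  set S := T.filter fun t => monomial t (1 : k) ∈ initialIdeal MonomialOrder.degLex I with hS
  have hex : ∀ a : S, ∃ f ∈ I, f.IsHomogeneous M.degree ∧ f ≠ 0 ∧
      MonomialOrder.degLex.degree f = a := by
    rintro ⟨t, ht⟩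
    rw [hS, Finset.mem_filter, mem_monomialsGE] at ht
    obtain ⟨f, hf⟩ := exists_homogeneous_of_monomial_mem_initialIdeal hI ht.2
    rw [ht.1.1, hNd] at hf
    exact ⟨f, hf⟩
  choose f hfI hfd hf0 hfdeg using hex
  obtain ⟨h, hh⟩ := exists_linSubst_shearMatrix_eq j l f₀
  have hcoeff₀ (t : T) : coeff (t : Fin n →₀ ℕ) f₀ = 0 :=
    MonomialOrder.degLex.coeff_eq_zero_of_lt (hMN.trans_le (mem_monomialsGE.mp t.2).2)
  -- the `T`-coefficients of the sheared `f₀` vanish at `s = 0`, so they can be divided by `s`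
  let V : Option S → T → Polynomial k := fun a t => a.elim
    (Polynomial.C (coeff (t : Fin n →₀ ℕ) (X j * pderiv l f₀)) + Polynomial.X * coeff t h)
    fun a => coeff (t : Fin n →₀ ℕ) (linSubst (shearMatrix k j l) (f a))
  have hV0 : LinearIndependent k fun a t => Polynomial.aeval (0 : k) (V a t) := by
    have hind := linearIndependent_coeff_of_injective MonomialOrder.degLex T
      (fun a : Option S => a.elim (X j * pderiv l f₀) f) (fun a => a.elim N fun a => a) ?_ ?_ ?_ ?_
    · convert hind using 3 with a t
      rcases a with _ | a
      · simp [V]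
      · simp only [V, Option.elim_some]
        rw [map_coeff_linSubst, shearMatrix_map_aeval_zero, linSubst_one]
    · have hNS (a : S) : (a : Fin n →₀ ℕ) ≠ N := fun he =>
        hN (he ▸ (Finset.mem_filter.mp a.2).2)
      rintro (_ | a) (_ | b) hab
      · rfl
      · exact absurd hab.symm (hNS b)
      · exact absurd hab (hNS a)
      · exact congrArg some (Subtype.ext hab)
    · rintro (_ | a)
      · exact mem_monomialsGE.mpr ⟨rfl, le_rfl⟩
      · exact (Finset.mem_filter.mp a.2).1
    · rintro (_ | a)
      · exact coeff_X_mul_pderiv_ne_zero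
          (MonomialOrder.degLex.coeff_degree_ne_zero_iff.mpr hf₀0) hl
      · have := MonomialOrder.degLex.coeff_degree_ne_zero_iff.mpr (hf0 a)
        rwa [hfdeg] at this
    · rintro (_ | a) t _ ht
      · exact coeff_X_mul_pderiv_eq_zero_of_lt hl ht
      · exact MonomialOrder.degLex.coeff_eq_zero_of_lt (by rw [Option.elim_some, hfdeg]; exact ht)
  obtain ⟨p, hp, hp'⟩ := exists_ne_zero_forall_linearIndependent V (Polynomial.aeval 0) hV0
  obtain ⟨s, hs0, hs⟩ : ∃ s : k, s ≠ 0 ∧ Polynomial.aeval s p ≠ 0 := by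
    by_contra! hcon
    have hp0 : p ≠ 0 := fun h0 => hp (by rw [h0, map_zero])
    refine mul_ne_zero Polynomial.X_ne_zero hp0 (Polynomial.funext fun s => ?_)
    by_cases hs0 : s = 0
    · simp [hs0]
    · have := hcon s hs0
      rw [Polynomial.coe_aeval_eq_eval] at this
      simp [this]
  have hind := hp' (Polynomial.aeval s) hs
  have hcard := card_le_card_filter_of_isGenericInitialIdeal (monomialsGE_upward N) hgen
    (fun a : Option S => a.elim (C s⁻¹ * f₀) f) (d := M.degree) ?_ ?_
    ((shearMatrix k j l).map (Polynomial.aeval s)) ?_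
  · rw [Fintype.card_option, Fintype.card_coe] at hcard
    exact absurd hcard (Nat.not_succ_le_self _)
  · rintro (_ | a)
    · exact I.mul_mem_left _ hf₀I
    · exact hfI a
  · rintro (_ | a)
    · simpa using (isHomogeneous_C _ s⁻¹).mul hf₀d
    · exact hfd a
  · convert hind using 3 with a t
    rcases a with _ | a
    · have h2 := congrArg (Polynomial.aeval s) (coeff_linSubst_shearMatrix hh t)
      rw [map_coeff_linSubst, hcoeff₀, map_zero, zero_add, map_mul, Polynomial.aeval_X] at h2
      simp only [V, Option.elim_none]
      rw [map_mul, algHom_C, MvPolynomial.algebraMap_eq, coeff_C_mul, h2,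
        inv_mul_cancel_left₀ hs0]
    · simp only [V, Option.elim_some]
      rw [map_coeff_linSubst]

end Stability

/-! ### Partial elimination ideals and initial ideals -/

section PartialElimination

variable {r : ℕ} {k : Type*} [Field k]

theorem Finsupp.degree_cons (i : ℕ) (M : Fin r →₀ ℕ) : (M.cons i).degree = i + M.degree := by
  simp [Finsupp.degree_eq_sum, Fin.sum_univ_succ]

theorem degLex_cons_lt_cons_of_lt {i j : ℕ} (hij : i < j) {M N : Fin r →₀ ℕ}
    (h : (M.cons i).degree = (N.cons j).degree) :
    M.cons i ≺[MonomialOrder.degLex] N.cons j := by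
  rw [MonomialOrder.degLex_lt_iff, Finsupp.DegLex.lt_iff]
  exact Or.inr ⟨h, 0, fun d hd => absurd hd (Fin.not_lt_zero d), hij⟩

theorem degLex_cons_lt_cons (i : ℕ) {M N : Fin r →₀ ℕ} (h : M ≺[MonomialOrder.degLex] N) :
    M.cons i ≺[MonomialOrder.degLex] N.cons i := by
  rw [MonomialOrder.degLex_lt_iff, Finsupp.DegLex.lt_iff] at h ⊢
  simp only [ofDegLex_toDegLex, Finsupp.degree_cons, add_lt_add_iff_left, add_right_inj] at h ⊢
  refine h.imp_right fun h => ⟨h.1, ?_⟩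
  obtain ⟨l, hl, hlt⟩ := h.2
  refine ⟨l.succ, fun d hd => ?_, hlt⟩
  induction d using Fin.cases with
  | zero => rfl
  | succ d => exact hl d (Fin.succ_lt_succ_iff.mp hd)

theorem degLex_cons_le_cons_iff (i : ℕ) {M N : Fin r →₀ ℕ} :
    M.cons i ≼[MonomialOrder.degLex] N.cons i ↔ M ≼[MonomialOrder.degLex] N := by
  refine ⟨fun h => ?_, fun h => ?_⟩
  · by_contra! hcon
    exact (degLex_cons_lt_cons i hcon).not_ge h
  · rcases h.lt_or_eq with h | h
    · exact (degLex_cons_lt_cons i h).le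
    · rw [MonomialOrder.degLex.toSyn.injective h]

theorem coeff_coeffXZero (i : ℕ) (f : MvPolynomial (Fin (r + 1)) k) (M : Fin r →₀ ℕ) :
    coeff M (coeffXZero i f) = coeff (M.cons i) f :=
  finSuccEquiv_coeff_coeff M f i

/-- The leading monomial of `f̄` is the leading monomial of `f` with its power of `x_0` removed. -/
theorem degree_coeffXZero {i : ℕ} {f : MvPolynomial (Fin (r + 1)) k} (h0 : f ≠ 0)
    {M : Fin r →₀ ℕ} (hM : MonomialOrder.degLex.degree f = M.cons i) :
    coeffXZero i f ≠ 0 ∧ MonomialOrder.degLex.degree (coeffXZero i f) = M := by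
  have hc : coeff M (coeffXZero i f) ≠ 0 := by
    rw [coeff_coeffXZero, ← hM]
    exact MonomialOrder.degLex.coeff_degree_ne_zero_iff.mpr h0
  refine ⟨fun h => hc (by rw [h, coeff_zero]),
    MonomialOrder.degree_eq_of_support_le _ hc fun u hu => ?_⟩
  rw [mem_support_iff, coeff_coeffXZero, ← mem_support_iff] at hu
  rw [← degLex_cons_le_cons_iff i, ← hM]
  exact MonomialOrder.degLex.le_degree hu

theorem degreeOf_zero_homogeneousComponent_le (d : ℕ) (f : MvPolynomial (Fin (r + 1)) k) :
    degreeOf 0 (homogeneousComponent d f) ≤ degreeOf 0 f := by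
  rw [degreeOf_le_iff]
  intro m hm
  rw [support_homogeneousComponent, Finset.mem_filter] at hm
  exact monomial_le_degreeOf 0 hm.1

theorem mem_partialElimAux_iff {I : Ideal (MvPolynomial (Fin (r + 1)) k)}
    (hI : I.IsHomogeneous (homogeneousSubmodule (Fin (r + 1)) k)) {i : ℕ}
    {F : MvPolynomial (Fin (r + 1)) k} :
    F ∈ partialElimAux i I ↔ F ∈ I ∧ degreeOf 0 F ≤ i := by
  constructor
  · intro h
    induction h using Submodule.span_induction with
    | mem x hx =>
      obtain ⟨hxI, ⟨d, hd⟩, hx⟩ := hx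
      exact ⟨hxI, by rwa [← leadPower_eq_degreeOf hd]⟩
    | zero => exact ⟨I.zero_mem, by simp⟩
    | add x y _ _ hx hy =>
      exact ⟨add_mem hx.1 hy.1, (degreeOf_add_le _ _ _).trans (max_le hx.2 hy.2)⟩
    | smul a x _ hx =>
      rw [smul_eq_C_mul]
      exact ⟨I.mul_mem_left _ hx.1, (degreeOf_C_mul_le _ _ _).trans hx.2⟩
  · rintro ⟨hF, hFi⟩
    rw [← sum_homogeneousComponent F]
    refine sum_mem fun d _ => Submodule.subset_span ⟨homogeneousComponent_mem_of_mem hI hF d,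
      ⟨d, homogeneousComponent_isHomogeneous d F⟩, ?_⟩
    rw [leadPower_eq_degreeOf (homogeneousComponent_isHomogeneous d F)]
    exact (degreeOf_zero_homogeneousComponent_le d F).trans hFi

theorem mem_partialElimIdeal_iff {I : Ideal (MvPolynomial (Fin (r + 1)) k)}
    (hI : I.IsHomogeneous (homogeneousSubmodule (Fin (r + 1)) k)) {i : ℕ}
    {x : MvPolynomial (Fin r) k} :
    x ∈ partialElimIdeal i I ↔ ∃ F ∈ I, degreeOf 0 F ≤ i ∧ coeffXZero i F = x := by
  change (∃ F, F ∈ partialElimAux i I ∧ coeffXZero i F = x) ↔ _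
  simp only [mem_partialElimAux_iff hI, and_assoc]

theorem homogeneousComponent_coeffXZero (i e : ℕ) (F : MvPolynomial (Fin (r + 1)) k) :
    homogeneousComponent e (coeffXZero i F) = coeffXZero i (homogeneousComponent (i + e) F) := by
  ext M
  rw [coeff_homogeneousComponent, coeff_coeffXZero, coeff_coeffXZero, coeff_homogeneousComponent,
    Finsupp.degree_cons]
  simp only [add_right_inj]

theorem partialElimIdeal_isHomogeneous {I : Ideal (MvPolynomial (Fin (r + 1)) k)}
    (hI : I.IsHomogeneous (homogeneousSubmodule (Fin (r + 1)) k)) (i : ℕ) :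
    (partialElimIdeal i I).IsHomogeneous (homogeneousSubmodule (Fin r) k) := by
  intro e x hx
  obtain ⟨F, hF, hFi, rfl⟩ := (mem_partialElimIdeal_iff hI).mp hx
  change (decomposition.decompose' (coeffXZero i F) e : MvPolynomial (Fin r) k) ∈ _
  rw [decomposition.decompose'_apply, homogeneousComponent_coeffXZero]
  exact (mem_partialElimIdeal_iff hI).mpr ⟨_, homogeneousComponent_mem_of_mem hI hF _,
    (degreeOf_zero_homogeneousComponent_le _ F).trans hFi, rfl⟩

/-- The initial ideals of the partial elimination ideals are the slices of `in(I)` by the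
exponent of `x_0`. -/
theorem monomial_mem_initialIdeal_partialElimIdeal_iff {I : Ideal (MvPolynomial (Fin (r + 1)) k)}
    (hI : I.IsHomogeneous (homogeneousSubmodule (Fin (r + 1)) k)) {i : ℕ} {M : Fin r →₀ ℕ} :
    monomial M (1 : k) ∈ initialIdeal MonomialOrder.degLex (partialElimIdeal i I) ↔
      monomial (M.cons i) (1 : k) ∈ initialIdeal MonomialOrder.degLex I := by
  constructor
  · intro h
    obtain ⟨x, hx, hxd, hx0, rfl⟩ :=
      exists_homogeneous_of_monomial_mem_initialIdeal (partialElimIdeal_isHomogeneous hI i) h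
    set M := MonomialOrder.degLex.degree x
    obtain ⟨F, hF, hFi, hFx⟩ := (mem_partialElimIdeal_iff hI).mp hx
    set F' := homogeneousComponent (i + M.degree) F with hF'
    have hFx' : coeffXZero i F' = x := by
      rw [hF', ← homogeneousComponent_coeffXZero, hFx, homogeneousComponent_eq_self hxd]
    have hc : coeff (M.cons i) F' ≠ 0 := by
      rw [← coeff_coeffXZero, hFx']
      exact MonomialOrder.degLex.coeff_degree_ne_zero_iff.mpr hx0
    have hdeg : MonomialOrder.degLex.degree F' = M.cons i := by
      refine MonomialOrder.degree_eq_of_support_le _ hc fun u hu => ?_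
      have hu0 : u 0 ≤ i := (monomial_le_degreeOf 0 hu).trans
        ((degreeOf_zero_homogeneousComponent_le _ F).trans hFi)
      have hud := IsHomogeneous.degree_of_mem_support
        (homogeneousComponent_isHomogeneous (i + M.degree) F) hu
      rw [← Finsupp.degree_cons] at hud
      rcases hu0.lt_or_eq with hlt | heq
      · rw [← u.cons_tail] at hud ⊢
        exact (degLex_cons_lt_cons_of_lt hlt hud).le
      · rw [← u.cons_tail, heq, mem_support_iff, ← coeff_coeffXZero, hFx',
          ← mem_support_iff] at hu
        rw [← u.cons_tail, heq, degLex_cons_le_cons_iff]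
        exact MonomialOrder.degLex.le_degree hu
    rw [← hdeg]
    exact monomial_degree_mem_initialIdeal _ (homogeneousComponent_mem_of_mem hI hF _)
      fun h => hc (by rw [h, coeff_zero])
  · intro h
    obtain ⟨f, hf, hfd, hf0, hdeg⟩ := exists_homogeneous_of_monomial_mem_initialIdeal hI h
    obtain ⟨h0, hM⟩ := degree_coeffXZero hf0 hdeg
    have hle : degreeOf 0 f ≤ i := by
      rw [← leadPower_eq_degreeOf hfd, leadPower, hdeg, Finsupp.cons_zero]
    have := monomial_degree_mem_initialIdeal MonomialOrder.degLex
      ((mem_partialElimIdeal_iff hI).mpr ⟨f, hf, hle, rfl⟩) h0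
    rwa [hM] at this

end PartialElimination

/-! ### Coordinate changes that fix `x_0` -/

section BlockMatrix

variable {r : ℕ} {k : Type*} [Field k]

/-- The block diagonal matrix `diag(1, A)`, as a monoid homomorphism in `A`. -/
def blockMatrix {R : Type*} [CommRing R] :
    Matrix (Fin r) (Fin r) R →* Matrix (Fin (r + 1)) (Fin (r + 1)) R where
  toFun A := Matrix.of fun i j =>
    Fin.cases (Fin.cases 1 (fun _ => 0) j) (fun i' => Fin.cases 0 (fun j' => A i' j') j) i
  map_one' := by
    ext i j
    induction i using Fin.cases <;> induction j using Fin.cases <;>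
      simp [Matrix.one_apply, Fin.succ_ne_zero, (Fin.succ_ne_zero _).symm]
  map_mul' A B := by
    ext i j
    induction i using Fin.cases <;> induction j using Fin.cases <;>
      simp [Matrix.mul_apply, Fin.sum_univ_succ]

@[simp] theorem blockMatrix_zero_zero {R : Type*} [CommRing R] (A : Matrix (Fin r) (Fin r) R) :
    blockMatrix A 0 0 = 1 := rfl

@[simp] theorem blockMatrix_zero_succ {R : Type*} [CommRing R] (A : Matrix (Fin r) (Fin r) R)
    (j : Fin r) : blockMatrix A 0 j.succ = 0 := rfl

@[simp] theorem blockMatrix_succ_zero {R : Type*} [CommRing R] (A : Matrix (Fin r) (Fin r) R)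
    (i : Fin r) : blockMatrix A i.succ 0 = 0 := rfl

@[simp] theorem blockMatrix_succ_succ {R : Type*} [CommRing R] (A : Matrix (Fin r) (Fin r) R)
    (i j : Fin r) : blockMatrix A i.succ j.succ = A i j := rfl

theorem finSuccEquiv_linSubst_blockMatrix (A : Matrix (Fin r) (Fin r) k)
    (f : MvPolynomial (Fin (r + 1)) k) :
    finSuccEquiv k r (linSubst (blockMatrix A) f) =
      (finSuccEquiv k r f).map (linSubst (k := k) A : MvPolynomial (Fin r) k →+* _) := by
  induction f using MvPolynomial.induction_on with
  | C a => simp [linSubst, finSuccEquiv_apply]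
  | add p q hp hq => simp only [map_add, hp, hq, Polynomial.map_add]
  | mul_X p j hp =>
    rw [map_mul, map_mul, map_mul, Polynomial.map_mul, hp]
    refine congrArg _ ?_
    induction j using Fin.cases with
    | zero => simp [linSubst, Fin.sum_univ_succ, finSuccEquiv_X_zero]
    | succ j =>
      simp [linSubst, Fin.sum_univ_succ, finSuccEquiv_apply]

theorem coeffXZero_linSubst_blockMatrix (A : Matrix (Fin r) (Fin r) k) (i : ℕ)
    (f : MvPolynomial (Fin (r + 1)) k) :
    coeffXZero i (linSubst (blockMatrix A) f) = linSubst A (coeffXZero i f) := by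
  change (finSuccEquiv k r (linSubst (blockMatrix A) f)).coeff i =
    linSubst A ((finSuccEquiv k r f).coeff i)
  rw [finSuccEquiv_linSubst_blockMatrix, Polynomial.coeff_map]
  rfl

theorem degreeOf_zero_linSubst_blockMatrix_le (A : Matrix (Fin r) (Fin r) k)
    (f : MvPolynomial (Fin (r + 1)) k) :
    degreeOf 0 (linSubst (blockMatrix A) f) ≤ degreeOf 0 f := by
  rw [← natDegree_finSuccEquiv, ← natDegree_finSuccEquiv, finSuccEquiv_linSubst_blockMatrix]
  exact Polynomial.natDegree_map_le

/-- Forming partial elimination ideals commutes with coordinate changes of `x_1, …, x_r`. -/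
theorem partialElimIdeal_transform_blockMatrix {I : Ideal (MvPolynomial (Fin (r + 1)) k)}
    (hI : I.IsHomogeneous (homogeneousSubmodule (Fin (r + 1)) k)) (i : ℕ) (h : GL (Fin r) k) :
    partialElimIdeal i (transform (Units.map blockMatrix h) I) =
      transform h (partialElimIdeal i I) := by
  ext x
  rw [mem_partialElimIdeal_iff (transform_isHomogeneous hI _), mem_transform_iff]
  constructor
  · rintro ⟨F, hF, hFi, rfl⟩
    obtain ⟨F', hF', rfl⟩ := mem_transform_iff.mp hF
    refine ⟨coeffXZero i F', (mem_partialElimIdeal_iff hI).mpr ⟨F', hF', ?_, rfl⟩,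
      (coeffXZero_linSubst_blockMatrix _ i F').symm⟩
    rw [← coordChange_inv_coordChange (Units.map blockMatrix h) F', ← map_inv]
    exact (degreeOf_zero_linSubst_blockMatrix_le _ _).trans hFi
  · rintro ⟨_, hy, rfl⟩
    obtain ⟨F, hF, hFi, rfl⟩ := (mem_partialElimIdeal_iff hI).mp hy
    exact ⟨coordChange (Units.map blockMatrix h) F, mem_transform_iff.mpr ⟨F, hF, rfl⟩,
      (degreeOf_zero_linSubst_blockMatrix_le _ F).trans hFi,
      coeffXZero_linSubst_blockMatrix _ i F⟩

theorem partialElimIdeal_inGenericCoordinates [Infinite k]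
    {I : Ideal (MvPolynomial (Fin (r + 1)) k)}
    (hI : I.IsHomogeneous (homogeneousSubmodule (Fin (r + 1)) k))
    (hgen : InGenericCoordinates MonomialOrder.degLex I) (i : ℕ) :
    InGenericCoordinates MonomialOrder.degLex (partialElimIdeal i I) := by
  obtain ⟨p, hp1, hp⟩ := hgen.exists_polynomial hI
  -- `q(A) = p(diag(1, A))`
  let q : MvPolynomial (Fin r × Fin r) k :=
    aeval (fun ij => blockMatrix (Matrix.mvPolynomialX (Fin r) (Fin r) k) ij.1 ij.2) p
  have hq (A : Matrix (Fin r) (Fin r) k) : eval (fun ij => A ij.1 ij.2) q =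
      eval (fun ij => blockMatrix A ij.1 ij.2) p := by
    have : (aeval (fun ij : Fin r × Fin r => A ij.1 ij.2)).comp
        (aeval fun ij : Fin (r + 1) × Fin (r + 1) =>
          blockMatrix (Matrix.mvPolynomialX (Fin r) (Fin r) k) ij.1 ij.2) =
        aeval (R := k) (fun ij : Fin (r + 1) × Fin (r + 1) => blockMatrix A ij.1 ij.2) := by
      refine MvPolynomial.algHom_ext fun ⟨a, b⟩ => ?_
      induction a using Fin.cases <;> induction b using Fin.cases <;> simp
    exact AlgHom.congr_fun this p
  refine ⟨{h | ∃ p ∈ ({q} : Set _),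
    eval (fun ij => (h : Matrix (Fin r) (Fin r) k) ij.1 ij.2) p ≠ 0}, ⟨{q}, rfl⟩,
    ⟨1, q, rfl, ?_⟩, ?_⟩
  · rw [Units.val_one, hq, map_one]
    exact hp1
  · rintro h ⟨_, rfl, hh⟩
    rw [hq] at hh
    have hin := hp (Units.map blockMatrix h) (by rw [Units.coe_map]; exact hh)
    rw [← partialElimIdeal_transform_blockMatrix hI]
    have hmem (M : Fin r →₀ ℕ) : monomial M (1 : k) ∈ initialIdeal MonomialOrder.degLex
        (partialElimIdeal i (transform (Units.map blockMatrix h) I)) ↔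
        monomial M (1 : k) ∈ initialIdeal MonomialOrder.degLex (partialElimIdeal i I) := by
      rw [monomial_mem_initialIdeal_partialElimIdeal_iff (transform_isHomogeneous hI _), hin,
        monomial_mem_initialIdeal_partialElimIdeal_iff hI]
    exact le_antisymm (initialIdeal_le_of_monomial_mem _ fun M => (hmem M).mp)
      (initialIdeal_le_of_monomial_mem _ fun M => (hmem M).mpr)

end BlockMatrix

/-! ### Minimal generators and Gröbner bases of partial elimination ideals -/

section MinimalGenerators

variable {r : ℕ} {k : Type*} [Field k]

theorem Finsupp.cons_le_cons {i j : ℕ} {M N : Fin r →₀ ℕ} (hij : i ≤ j) (hMN : M ≤ N) :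
    M.cons i ≤ N.cons j := by
  intro l
  induction l using Fin.cases with
  | zero => exact hij
  | succ l => exact hMN l

theorem Finsupp.tail_le_tail {M N : Fin (r + 1) →₀ ℕ} (h : M ≤ N) : M.tail ≤ N.tail :=
  fun l => h l.succ

theorem IsMinimalGenerator.of_cons {I : Ideal (MvPolynomial (Fin (r + 1)) k)}
    (hI : I.IsHomogeneous (homogeneousSubmodule (Fin (r + 1)) k)) {i : ℕ} {M : Fin r →₀ ℕ}
    (h : IsMinimalGenerator (initialIdeal MonomialOrder.degLex I) (M.cons i)) :
    IsMinimalGenerator (initialIdeal MonomialOrder.degLex (partialElimIdeal i I)) M := by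
  refine ⟨(monomial_mem_initialIdeal_partialElimIdeal_iff hI).mpr h.1, fun N hN hNM => ?_⟩
  have := h.2 ((monomial_mem_initialIdeal_partialElimIdeal_iff hI).mp hN)
    (Finsupp.cons_le_cons le_rfl hNM)
  simpa using Finsupp.tail_le_tail this

/-- A proper divisor of `x_0 ^ i * M` in `in(I)` can only lose powers of `x_0`, since `M` is minimal
in its slice; strong stability then trades a variable of `M` for the missing `x_0`. -/
theorem IsMinimalGenerator.cons [CharZero k] {I : Ideal (MvPolynomial (Fin (r + 1)) k)}
    (hI : I.IsHomogeneous (homogeneousSubmodule (Fin (r + 1)) k))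
    (hgen : InGenericCoordinates MonomialOrder.degLex I) {i : ℕ} {M : Fin r →₀ ℕ}
    (hi : (∀ j < i, ∀ f ∈ I, f.IsHomogeneous j → f = 0) ∨ M ≠ 0)
    (h : IsMinimalGenerator (initialIdeal MonomialOrder.degLex (partialElimIdeal i I)) M) :
    IsMinimalGenerator (initialIdeal MonomialOrder.degLex I) (M.cons i) := by
  refine ⟨(monomial_mem_initialIdeal_partialElimIdeal_iff hI).mp h.1, fun N hN hle => ?_⟩
  have hN0 : N 0 ≤ i := hle 0
  have hNt : N.tail ≤ M := by simpa using Finsupp.tail_le_tail hle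
  rcases hN0.eq_or_lt with heq | hlt
  · rw [← N.cons_tail, heq] at hN ⊢
    exact Finsupp.cons_le_cons le_rfl
      (h.2 ((monomial_mem_initialIdeal_partialElimIdeal_iff hI).mpr hN) hNt)
  · exfalso
    obtain ⟨i, rfl⟩ : ∃ j, i = j + 1 := ⟨i - 1, by omega⟩
    have hmem : monomial (M.cons i) (1 : k) ∈ initialIdeal MonomialOrder.degLex I := by
      refine monomial_one_mem_of_le ?_ hN
      rw [← N.cons_tail]
      exact Finsupp.cons_le_cons (Nat.lt_succ_iff.mp hlt) hNt
    by_cases hM : M = 0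
    · obtain ⟨f, hf, hfd, hf0, -⟩ := exists_homogeneous_of_monomial_mem_initialIdeal hI hmem
      rw [hM, Finsupp.degree_cons, map_zero, add_zero] at hfd
      exact hf0 (hi.resolve_right (not_not.mpr hM) i (Nat.lt_succ_self i) f hf hfd)
    · obtain ⟨l, hl⟩ := Finsupp.ne_iff.mp hM
      have hex := hgen.exchange_mem hI (Fin.succ_pos l) hmem (by simpa using hl)
      have heq : M.cons i - Finsupp.single l.succ 1 + Finsupp.single 0 1 =
          (M - Finsupp.single l 1).cons (i + 1) := by
        ext a
        induction a using Fin.cases with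
        | zero => simp
        | succ a => simp [Finsupp.single_apply, Fin.succ_ne_zero]
      rw [heq, ← monomial_mem_initialIdeal_partialElimIdeal_iff hI] at hex
      have h1 := h.2 hex tsub_le_self l
      simp only [Finsupp.coe_tsub, Pi.sub_apply, Finsupp.single_eq_same] at h1
      have h2 : M l ≠ 0 := hl
      omega

theorem exists_mem_degree_eq_of_isMinimalGenerator {σ : Type*} {m : MonomialOrder σ}
    {I : Ideal (MvPolynomial σ k)} {G : Set (MvPolynomial σ k)} (hG : IsGroebnerBasis m I G)
    {M : σ →₀ ℕ} (hM : IsMinimalGenerator (initialIdeal m I) M) :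
    ∃ f ∈ G, m.degree f = M := by
  have hmem := hM.1
  rw [← hG.span_eq, MonomialOrder.span_leadingTerm_eq_span_monomial',
    ← Set.image_image (fun s => monomial s (1 : k)) m.degree, mem_ideal_span_monomial_image] at hmem
  obtain ⟨_, ⟨f, ⟨hf, hf0⟩, rfl⟩, hle⟩ := hmem M (by classical simp [support_monomial])
  exact ⟨f, hf, le_antisymm hle
    (hM.2 (monomial_degree_mem_initialIdeal m (hG.subset hf) hf0) hle)⟩

theorem isGroebnerBasis_partialElimBasis [CharZero k] {I : Ideal (MvPolynomial (Fin (r + 1)) k)}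
    (hI : I.IsHomogeneous (homogeneousSubmodule (Fin (r + 1)) k))
    (hgen : InGenericCoordinates MonomialOrder.degLex I)
    {G : Set (MvPolynomial (Fin (r + 1)) k)} (hG : IsGroebnerBasis MonomialOrder.degLex I G)
    (hGh : ∀ f ∈ G, ∃ d, f.IsHomogeneous d) {i : ℕ}
    (hi : ∀ j < i, ∀ f ∈ I, f.IsHomogeneous j → f = 0) :
    IsGroebnerBasis MonomialOrder.degLex (partialElimIdeal i I) (partialElimBasis i G) := by
  have hsub : partialElimBasis i G ⊆ (partialElimIdeal i I : Set (MvPolynomial (Fin r) k)) := by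
    rintro _ ⟨f, ⟨hf, hfi⟩, rfl⟩
    obtain ⟨d, hd⟩ := hGh f hf
    exact (mem_partialElimIdeal_iff hI).mpr
      ⟨f, hG.subset hf, by rw [← leadPower_eq_degreeOf hd, hfi], rfl⟩
  have hzero : (0 : MvPolynomial (Fin r) k) ∉ partialElimBasis i G := by
    rintro ⟨f, ⟨hf, hfi⟩, hf0⟩
    refine (degree_coeffXZero (i := i) (M := (MonomialOrder.degLex.degree f).tail)
      (fun h => hG.zero_notMem (h ▸ hf)) ?_).1 hf0
    rw [← hfi]
    exact (Finsupp.cons_tail _).symm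
  refine ⟨(hG.finite.subset fun f hf => hf.1).image _, hzero, hsub,
    le_antisymm (Ideal.span_mono (Set.image_mono hsub))
      (initialIdeal_le_of_monomial_mem _ fun M hM => ?_)⟩
  obtain ⟨N, hNM, hN⟩ := exists_minimal_le_of_wellFoundedLT
    (fun N : Fin r →₀ ℕ =>
      monomial N (1 : k) ∈ initialIdeal MonomialOrder.degLex (partialElimIdeal i I)) M hM
  obtain ⟨f, hf, hfdeg⟩ := exists_mem_degree_eq_of_isMinimalGenerator hG
    (IsMinimalGenerator.cons hI hgen (Or.inl hi) hN)
  obtain ⟨h0, hdeg⟩ := degree_coeffXZero (fun h => hG.zero_notMem (h ▸ hf)) hfdeg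
  refine monomial_one_mem_of_le hNM ?_
  rw [MonomialOrder.span_leadingTerm_eq_span_monomial', ← hdeg]
  refine Ideal.subset_span ⟨_, ⟨⟨f, ⟨hf, ?_⟩, rfl⟩, h0⟩, rfl⟩
  rw [leadPower, hfdeg, Finsupp.cons_zero]

end MinimalGenerators

theorem mainTheorem7 {k : Type*} [Field k] [IsAlgClosed k] [CharZero k] (r : ℕ)
    (I : Ideal (MvPolynomial (Fin (r + 1)) k))
    (hI : I.IsHomogeneous (homogeneousSubmodule (Fin (r + 1)) k))
    (hgen : InGenericCoordinates MonomialOrder.degLex I) :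
    (∀ i, (partialElimIdeal i I).IsHomogeneous (homogeneousSubmodule (Fin r) k) ∧
      InGenericCoordinates MonomialOrder.degLex (partialElimIdeal i I)) ∧
    (∀ G : Set (MvPolynomial (Fin (r + 1)) k), IsGroebnerBasis MonomialOrder.degLex I G →
      (∀ f ∈ G, ∃ d, f.IsHomogeneous d) →
      ∀ i, (∀ j < i, ∀ f ∈ I, f.IsHomogeneous j → f = 0) →
        IsGroebnerBasis MonomialOrder.degLex (partialElimIdeal i I) (partialElimBasis i G)) ∧
    (∀ i (M : Fin r →₀ ℕ),
      IsMinimalGenerator (initialIdeal MonomialOrder.degLex I) (Finsupp.cons i M) →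
        IsMinimalGenerator (initialIdeal MonomialOrder.degLex (partialElimIdeal i I)) M) ∧
    (∀ i (M : Fin r →₀ ℕ),
      ((∀ j < i, ∀ f ∈ I, f.IsHomogeneous j → f = 0) ∨ M ≠ 0) →
      IsMinimalGenerator (initialIdeal MonomialOrder.degLex (partialElimIdeal i I)) M →
        IsMinimalGenerator (initialIdeal MonomialOrder.degLex I) (Finsupp.cons i M)) := by
  exact ⟨fun i => ⟨partialElimIdeal_isHomogeneous hI i,
      partialElimIdeal_inGenericCoordinates hI hgen i⟩,
    fun G hG hGh i hi => isGroebnerBasis_partialElimBasis hI hgen hG hGh hi,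
    fun i M h => h.of_cons hI,
    fun i M hi h => h.cons hI hgen hi⟩
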